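/- Let $n\ge 4$ and $p=1+\frac2n$. Let $f\in H^1(\mathbb R^n)$ and $g\in L^2(\mathbb R^n)$ be real-valued, with $f\ge 0$ and $g\ge 0$ almost everywhere, with $f=g=0$ almost everywhere outside the unit ball $\{|x|\le 1\}$, and with $f$ and $g$ not both zero almost everywhere. Then there is a constant $C=C(n,f,g)>0$ such that the following holds for every $\varepsilon>0$ and every $T(\varepsilon)\in[0,\infty]$: if $u$ is a real-valued weak solution on $[0,T(\varepsilon))\times\mathbb R^n$ of the Cauchy problem $$u_{tt}-\Delta u+u_t=|u|^p,\qquad u(0,x)=\varepsilon f(x),\quad u_t(0,x)=\varepsilon g(x),$$ then $$T(\varepsilon)\le \exp\bigl(C\varepsilon^{-2/n}\bigr).$$ In particular no such solution exists globally in time. Here $u$ is called a weak solution on $[0,T)\times\mathbb R^n$ if $u\in L^p(K)$ for every compact $K\subset[0,T)\times\mathbb R^n$ and, for every real-valued $\varphi\in C_c^\infty(\mathbb R\times\mathbb R^n)$ whose support lies in $\{t<T\}$, $$\int_0^T\!\!\int_{\mathbb R^n}u\,(\varphi_{tt}-\Delta\varphi-\varphi_t)\,dx\,dt=\int_0^T\!\!\int_{\mathbb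 R^n}|u|^p\varphi\,dx\,dt+\varepsilon\int_{\mathbb R^n}\bigl((f+g)(x)\,\varphi(0,x)-f(x)\,\varphi_t(0,x)\bigr)dx.$$ Classical solutions, and finite-energy solutions $u\in C([0,T);H^1)\cap C^1([0,T);L^2)$, are weak solutions in this sense. -/

import Mathlib

open MeasureTheory Set
open scoped ENNReal ContDiff Laplacian

noncomputable section

/-- Membership of a real function on `ℝⁿ` in the Sobolev space `H¹(ℝⁿ)`: the function is square
integrable and has square integrable weak partial derivatives of first order. -/
def MemH1 {n : ℕ} (f : EuclideanSpace ℝ (Fin n) → ℝ) : Prop :=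
  MemLp f 2 volume ∧
  ∀ i : Fin n, ∃ h : EuclideanSpace ℝ (Fin n) → ℝ, MemLp h 2 volume ∧
    ∀ φ : EuclideanSpace ℝ (Fin n) → ℝ, ContDiff ℝ ∞ φ → HasCompactSupport φ →
      ∫ x, f x * fderiv ℝ φ x (EuclideanSpace.single i 1) = - ∫ x, h x * φ x

/-- The space-time slab `[0, T) × ℝⁿ`, where `0 ≤ T ≤ ∞`. -/
def slab (n : ℕ) (T : ℝ≥0∞) : Set (ℝ × EuclideanSpace ℝ (Fin n)) :=
  {z | 0 ≤ z.1 ∧ ENNReal.ofReal z.1 < T}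

/-- The formal adjoint of the damped wave operator: `φ_tt - Δφ - φ_t`. -/
def adjointOp {n : ℕ} (φ : ℝ → EuclideanSpace ℝ (Fin n) → ℝ) (t : ℝ)
    (x : EuclideanSpace ℝ (Fin n)) : ℝ :=
  iteratedDeriv 2 (fun s => φ s x) t - (Δ (φ t)) x - deriv (fun s => φ s x) t

/-- `u` solves, in the weak sense on `[0, T) × ℝⁿ`, the Cauchy problem
`u_tt - Δu + u_t = |u|^p`, `u(0) = u₀`, `u_t(0) = u₁`.
The function `u` is `L^p` on the compact subsets of `[0, T) × ℝⁿ`, and the equation and the initial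
data are tested against smooth, compactly supported functions on space-time whose support lies
in times `< T`; these need not vanish at `t = 0`. -/
structure IsWeakSolution {n : ℕ} (p : ℝ) (T : ℝ≥0∞) (u₀ u₁ : EuclideanSpace ℝ (Fin n) → ℝ)
    (u : ℝ → EuclideanSpace ℝ (Fin n) → ℝ) : Prop where
  memLp : ∀ K : Set (ℝ × EuclideanSpace ℝ (Fin n)), IsCompact K → K ⊆ slab n T →
    MemLp (fun z : ℝ × EuclideanSpace ℝ (Fin n) => u z.1 z.2) (ENNReal.ofReal p)
      (volume.restrict K)
  weak_eq : ∀ φ : ℝ → EuclideanSpace ℝ (Fin n) → ℝ,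
    ContDiff ℝ ∞ (fun z : ℝ × EuclideanSpace ℝ (Fin n) => φ z.1 z.2) →
    HasCompactSupport (fun z : ℝ × EuclideanSpace ℝ (Fin n) => φ z.1 z.2) →
    (tsupport (fun z : ℝ × EuclideanSpace ℝ (Fin n) => φ z.1 z.2) ⊆
      {z | ENNReal.ofReal z.1 < T}) →
    ∫ z in slab n T, u z.1 z.2 * adjointOp φ z.1 z.2 =
      (∫ z in slab n T, |u z.1 z.2| ^ p * φ z.1 z.2) +
      ∫ x, ((u₀ x + u₁ x) * φ 0 x - u₀ x * deriv (fun s => φ s x) 0)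

end

/-!
The proof is the test function method, with parabolic scaling, in a discretised form.

Let `p = 1 + 2 / n` and `q = p - 1 = 2 / n`. The test function at scale `r` is
`φ_r (t, x) = ζ (3 t / r², x / r) ^ (n + 2)` (`testFun`) for a fixed cutoff `ζ`. It equals `1` on the
unit ball at `t = 0`, so that the data contribute exactly `J = ε ∫ (f + g) > 0`, and it is admissible
as soon as `r² < T`. Since `n + 2` is twice the exponent conjugate to `p`, the adjoint operator
applied to `φ_r` is at most `M r⁻² φ_r ^ (1 / p)`, and it vanishes where `φ_r` is flat
(`exists_abs_adjointOp_testFun_le`). With `E r = ∫ |u|^p φ_r` (`weightedMass`), the weak equation and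
Hölder's inequality give
`(J + E r) ^ p ≤ D (E r - E (r / 2))` for `1 ≤ r`, `r² < T` (`exists_rpow_weightedMass_le`):
the region where `φ_r` is not flat lies outside the support of `φ_{r/2}`, and all powers of `r`
cancel because the cylinder carrying `φ_r` has measure of order `r ^ (n + 2)` and `p` is critical.

Along `r = 2 ^ k` this is a backward Euler inequality for `b' = b ^ p / D`, and each step lowers
`b ^ (-q)` by at least `q / D` (`rpow_neg_add_le_of_rpow_le_mul_sub`). Hence there are at most
`(D / q) J ^ (-q)` steps with `4 ^ k < T`, which bounds `log T` by a multiple of `ε ^ (-q)`.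
The step at scale `r = 1` is included in the count. This gives the bound for large `ε` too, where
the claimed lifespan is close to `1`.
-/

/-! ### Derivatives of powers and of rescaled functions -/

lemma HasCompactSupport.exists_norm_fderiv_le {F G : Type*} [NormedAddCommGroup F]
    [NormedSpace ℝ F] [NormedAddCommGroup G] [NormedSpace ℝ G] {ζ : F → G}
    (hc : HasCompactSupport ζ) (h : ContDiff ℝ 1 ζ) : ∃ A, ∀ z, ‖fderiv ℝ ζ z‖ ≤ A :=
  (hc.fderiv (𝕜 := ℝ)).exists_bound_of_continuous (h.continuous_fderiv (by simp))

lemma norm_smul_add_smulRight_le {F G : Type*} [NormedAddCommGroup F] [NormedSpace ℝ F]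
    [NormedAddCommGroup G] [NormedSpace ℝ G] (a : ℝ) (T : F →L[ℝ] G) (S : F →L[ℝ] ℝ) (w : G) :
    ‖a • T + S.smulRight w‖ ≤ ‖a‖ * ‖T‖ + ‖S‖ * ‖w‖ := by
  rw [← norm_smul, ← ContinuousLinearMap.norm_smulRight_apply]
  exact norm_add_le _ _

/-- A power of a cutoff controls its own first two derivatives: differentiating `ζ ^ (m + 2)` at most
twice leaves at least `m` factors `ζ`. -/
lemma exists_norm_fderiv_pow_le {F : Type*} [NormedAddCommGroup F] [NormedSpace ℝ F]
    {ζ : F → ℝ} (hζ : ContDiff ℝ ∞ ζ) (hc : HasCompactSupport ζ) (h0 : ∀ z, 0 ≤ ζ z)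
    (h1 : ∀ z, ζ z ≤ 1) (m : ℕ) :
    ∃ M : ℝ, 0 ≤ M ∧ ∀ z, ‖fderiv ℝ (fun z => ζ z ^ (m + 2)) z‖ ≤ M * ζ z ^ m ∧
      ‖fderiv ℝ (fderiv ℝ (fun z => ζ z ^ (m + 2))) z‖ ≤ M * ζ z ^ m := by
  have hd : Differentiable ℝ ζ := hζ.differentiable (by simp)
  have hζ' : ContDiff ℝ ∞ (fderiv ℝ ζ) := hζ.fderiv_right (by simp)
  have hd' : Differentiable ℝ (fderiv ℝ ζ) := hζ'.differentiable (by simp)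
  obtain ⟨A, hA⟩ := hc.exists_norm_fderiv_le (hζ.of_le (by simp))
  obtain ⟨B, hB⟩ := (hc.fderiv (𝕜 := ℝ)).exists_norm_fderiv_le (hζ'.of_le (by simp))
  have hA0 : 0 ≤ A := (norm_nonneg _).trans (hA 0)
  have hB0 : 0 ≤ B := (norm_nonneg _).trans (hB 0)
  have e1 : ∀ k z, HasFDerivAt (fun z => ζ z ^ (k + 1)) (((k + 1 : ℕ) * ζ z ^ k) • fderiv ℝ ζ z) z :=
    fun k z => by simpa using (hd z).hasFDerivAt.pow (k + 1)
  have e2 : fderiv ℝ (fun z => ζ z ^ (m + 2)) =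
      fun z => ((m + 2 : ℕ) * ζ z ^ (m + 1)) • fderiv ℝ ζ z :=
    funext fun z => (e1 (m + 1) z).fderiv
  have e3 : ∀ z, HasFDerivAt (fderiv ℝ (fun z => ζ z ^ (m + 2)))
      (((m + 2 : ℕ) * ζ z ^ (m + 1)) • fderiv ℝ (fderiv ℝ ζ) z +
        (((m + 2 : ℕ) : ℝ) • (((m + 1 : ℕ) * ζ z ^ m) • fderiv ℝ ζ z)).smulRight (fderiv ℝ ζ z)) z := by
    intro z
    rw [e2]
    exact ((e1 m z).const_mul ((m + 2 : ℕ) : ℝ)).smul (hd' z).hasFDerivAt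
  have hz : ∀ z, ζ z ^ (m + 1) ≤ ζ z ^ m := fun z =>
    pow_le_pow_of_le_one (h0 z) (h1 z) (Nat.le_succ m)
  refine ⟨(m + 2) * A + ((m + 2) * B + (m + 2) * (m + 1) * A * A), by positivity, fun z => ?_⟩
  have hp := pow_nonneg (h0 z) m
  have hp' := pow_nonneg (h0 z) (m + 1)
  have i1 : (m + 2) * ζ z ^ (m + 1) * ‖fderiv ℝ ζ z‖ ≤ (m + 2) * ζ z ^ m * A := by
    gcongr (m + 2) * ?_ * ?_
    exacts [hz z, hA z]
  have i2 : (m + 2) * ζ z ^ (m + 1) * ‖fderiv ℝ (fderiv ℝ ζ) z‖ ≤ (m + 2) * ζ z ^ m * B := by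
    gcongr (m + 2) * ?_ * ?_
    exacts [hz z, hB z]
  have i3 : (m + 2) * ((m + 1) * ζ z ^ m * ‖fderiv ℝ ζ z‖) * ‖fderiv ℝ ζ z‖ ≤
      (m + 2) * ((m + 1) * ζ z ^ m * A) * A := by
    gcongr
    exacts [hA z, hA z]
  constructor
  · rw [e2]
    simp only [norm_smul, norm_mul, norm_pow, Real.norm_of_nonneg (h0 z), Real.norm_natCast]
    push_cast
    have : 0 ≤ ((m + 2) * B + (m + 2) * (m + 1) * A * A) * ζ z ^ m := by positivity
    linarith
  · rw [(e3 z).fderiv]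
    refine (norm_smul_add_smulRight_le _ _ _ _).trans ?_
    simp only [norm_smul, norm_mul, norm_pow, Real.norm_of_nonneg (h0 z), Real.norm_natCast]
    push_cast
    have : 0 ≤ (m + 2) * A * ζ z ^ m := by positivity
    linarith

lemma fderiv_fderiv_comp_prodMk_smul {E : Type*} [NormedAddCommGroup E] [NormedSpace ℝ E]
    {χ : ℝ × E → ℝ} (hχ : ContDiff ℝ ∞ χ) (τ d : ℝ) (x v : E) :
    fderiv ℝ (fderiv ℝ (fun y => χ (τ, d • y))) x v v =
      d ^ 2 * fderiv ℝ (fderiv ℝ χ) (τ, d • x) (0, v) (0, v) := by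
  have hd : Differentiable ℝ χ := hχ.differentiable (by simp)
  have hχ' : ContDiff ℝ ∞ (fderiv ℝ χ) := hχ.fderiv_right (by simp)
  have hd' : Differentiable ℝ (fderiv ℝ χ) := hχ'.differentiable (by simp)
  have incl : ∀ y : E, HasFDerivAt (fun y => (τ, d • y))
      (d • ContinuousLinearMap.inr ℝ ℝ E) y := fun y => by
    refine ((hasFDerivAt_const τ y).prodMk ((hasFDerivAt_id y).const_smul d)).congr_fderiv ?_
    ext v <;> simp
  have s1 : fderiv ℝ (fun y => χ (τ, d • y)) = fun y =>
      (fderiv ℝ χ (τ, d • y)).comp (d • ContinuousLinearMap.inr ℝ ℝ E) := funext fun y =>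
    ((hd (τ, d • y)).hasFDerivAt.comp y (incl y)).fderiv
  have s2 : HasFDerivAt (fun y => fderiv ℝ χ (τ, d • y))
      ((fderiv ℝ (fderiv ℝ χ) (τ, d • x)).comp (d • ContinuousLinearMap.inr ℝ ℝ E)) x :=
    (hd' (τ, d • x)).hasFDerivAt.comp x (incl x)
  rw [s1, (s2.clm_comp (hasFDerivAt_const (d • ContinuousLinearMap.inr ℝ ℝ E) x)).fderiv]
  simp [pow_two, mul_assoc]

/-- The adjoint operator applied to a rescaled function: time derivatives scale by `c`, space
derivatives by `d`. -/
lemma adjointOp_comp_scaling {n : ℕ} {χ : ℝ × EuclideanSpace ℝ (Fin n) → ℝ} (hχ : ContDiff ℝ ∞ χ)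
    (c d t : ℝ) (x : EuclideanSpace ℝ (Fin n)) :
    adjointOp (fun t x => χ (c * t, d • x)) t x =
      c ^ 2 * fderiv ℝ (fderiv ℝ χ) (c * t, d • x) (1, 0) (1, 0) -
      d ^ 2 * ∑ i : Fin n, fderiv ℝ (fderiv ℝ χ) (c * t, d • x)
        (0, EuclideanSpace.single i 1) (0, EuclideanSpace.single i 1) -
      c * fderiv ℝ χ (c * t, d • x) (1, 0) := by
  have hd : Differentiable ℝ χ := hχ.differentiable (by simp)
  have hχ' : ContDiff ℝ ∞ (fderiv ℝ χ) := hχ.fderiv_right (by simp)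
  have hd' : Differentiable ℝ (fderiv ℝ χ) := hχ'.differentiable (by simp)
  have line : ∀ s, HasDerivAt (fun s => ((c * s, d • x) : ℝ × EuclideanSpace ℝ (Fin n)))
      (c, 0) s := fun s => by
    simpa using ((hasDerivAt_id s).const_mul c).prodMk (hasDerivAt_const s (d • x))
  have hc : ((c, 0) : ℝ × EuclideanSpace ℝ (Fin n)) = c • (1, 0) := by simp
  have t1 : ∀ s, HasDerivAt (fun s => χ (c * s, d • x))
      (c * fderiv ℝ χ (c * s, d • x) (1, 0)) s := fun s => by
    have := (hd (c * s, d • x)).hasFDerivAt.comp_hasDerivAt s (line s)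
    rwa [hc, map_smul, smul_eq_mul] at this
  have t2 : HasDerivAt (fun s => c * fderiv ℝ χ (c * s, d • x) (1, 0))
      (c * (c * fderiv ℝ (fderiv ℝ χ) (c * t, d • x) (1, 0) (1, 0))) t := by
    have := (hd' (c * t, d • x)).hasFDerivAt.comp_hasDerivAt t (line t)
    rw [hc, map_smul] at this
    have := (this.clm_apply (hasDerivAt_const t ((1, 0) : ℝ × EuclideanSpace ℝ (Fin n)))).const_mul c
    simpa using this
  unfold adjointOp
  rw [(t1 t).deriv, iteratedDeriv_succ, iteratedDeriv_one, funext fun s => (t1 s).deriv, t2.deriv,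
    InnerProductSpace.laplacian_eq_iteratedFDeriv_orthonormalBasis _
      (EuclideanSpace.basisFun (Fin n) ℝ)]
  simp only [iteratedFDeriv_two_apply, EuclideanSpace.basisFun_apply, Matrix.cons_val_zero,
    Matrix.cons_val_one, fderiv_fderiv_comp_prodMk_smul hχ,
    ← Finset.mul_sum]
  ring

/-! ### A discrete differential inequality -/

/-- One backward Euler step of `b' = b ^ (1 + q) / D` lowers `b ^ (-q)` by at least `q / D`. -/
lemma rpow_neg_add_le_of_rpow_le_mul_sub {a b q D : ℝ} (hq : 0 < q) (hD : 0 < D) (ha : 0 < a)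
    (hb : 0 < b) (h : b ^ (1 + q) ≤ D * (b - a)) : b ^ (-q) + q / D ≤ a ^ (-q) := by
  have hbq : 0 < b ^ q := Real.rpow_pos_of_pos hb q
  have hle : a ≤ b * (1 - b ^ q / D) := by
    rw [Real.rpow_add hb, Real.rpow_one] at h
    have : b * b ^ q / D ≤ b - a := by rwa [div_le_iff₀' hD]
    have e : b * (1 - b ^ q / D) = b - b * b ^ q / D := by ring
    linarith
  have hexp : a ≤ b * Real.exp (-(b ^ q / D)) :=
    hle.trans (mul_le_mul_of_nonneg_left (Real.one_sub_le_exp_neg _) hb.le)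
  calc b ^ (-q) + q / D = b ^ (-q) * (1 + q * (b ^ q / D)) := by
        rw [Real.rpow_neg hb.le]; field_simp
    _ ≤ b ^ (-q) * Real.exp (q * (b ^ q / D)) := by
        gcongr
        linarith [Real.add_one_le_exp (q * (b ^ q / D))]
    _ = (b * Real.exp (-(b ^ q / D))) ^ (-q) := by
        rw [Real.mul_rpow hb.le (Real.exp_pos _).le, ← Real.exp_mul]
        ring_nf
    _ ≤ a ^ (-q) := Real.rpow_le_rpow_of_nonpos ha hexp (by linarith)

/-- A positive sequence can satisfy the backward Euler inequality only for a number of steps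
controlled by its initial value. -/
lemma steps_le_of_rpow_le_mul_sub {b : ℕ → ℝ} {q D : ℝ} (hq : 0 < q) (hD : 0 < D)
    (hb : ∀ k, 0 < b k) {N : ℕ}
    (h : ∀ k < N, b (k + 1) ^ (1 + q) ≤ D * (b (k + 1) - b k)) :
    N * (q / D) ≤ b 0 ^ (-q) := by
  have key : ∀ k ≤ N, b k ^ (-q) + k * (q / D) ≤ b 0 ^ (-q) := by
    intro k
    induction k with
    | zero => simp
    | succ k ih =>
      intro hk
      have := rpow_neg_add_le_of_rpow_le_mul_sub hq hD (hb k) (hb (k + 1)) (h k hk)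
      push_cast
      linarith [ih (by omega)]
  linarith [key N le_rfl, Real.rpow_nonneg (hb N).le (-q)]

/-! ### Parabolically rescaled test functions -/

/-- A smooth cutoff on space-time: equal to `1` on the ball of radius `2` and supported in the ball
of radius `3`, for the maximum norm on `ℝ × ℝⁿ`. -/
noncomputable def cutoff (n : ℕ) : ContDiffBump (0 : ℝ × EuclideanSpace ℝ (Fin n)) :=
  ⟨2, 3, by norm_num, by norm_num⟩

/-- The parabolic rescaling `(t, x) ↦ (3 t / r², x / r)`. The factor `3` makes the pulled back cutoff
vanish for `|t| > r²`. -/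
noncomputable def parabolicScaling {n : ℕ} (r : ℝ) (z : ℝ × EuclideanSpace ℝ (Fin n)) :
    ℝ × EuclideanSpace ℝ (Fin n) :=
  (3 / r ^ 2 * z.1, r⁻¹ • z.2)

/-- The test function at scale `r`. The power `n + 2` is twice the exponent conjugate to
`p = 1 + 2 / n`, so that two derivatives still leave the factor `cutoff ^ n`, which is the `p`-th
root of the test function. -/
noncomputable def testFun (n : ℕ) (r t : ℝ) (x : EuclideanSpace ℝ (Fin n)) : ℝ :=
  cutoff n (parabolicScaling r (t, x)) ^ (n + 2)

/-- The space-time cylinder `[0, r²] × {|x| ≤ 3 r}`, which contains the part of the support of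
`testFun n r` in nonnegative times. -/
def parabolicCylinder (n : ℕ) (r : ℝ) : Set (ℝ × EuclideanSpace ℝ (Fin n)) :=
  Icc 0 (r ^ 2) ×ˢ Metric.closedBall 0 (3 * r)

section
variable {n : ℕ}

lemma continuous_parabolicScaling (r : ℝ) : Continuous (parabolicScaling (n := n) r) := by
  unfold parabolicScaling
  fun_prop

lemma cutoff_eq_one {z : ℝ × EuclideanSpace ℝ (Fin n)} (h : ‖z‖ ≤ 2) : cutoff n z = 1 :=
  (cutoff n).one_of_mem_closedBall (by simpa [cutoff] using h)

lemma cutoff_eq_zero {z : ℝ × EuclideanSpace ℝ (Fin n)} (h : 3 ≤ ‖z‖) : cutoff n z = 0 :=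
  (cutoff n).zero_of_le_dist (by simpa [cutoff] using h)

lemma contDiff_cutoff_pow (k : ℕ) : ContDiff ℝ ∞ (fun z => cutoff n z ^ k) :=
  (cutoff n).contDiff.pow k

lemma contDiff_testFun (r : ℝ) :
    ContDiff ℝ ∞ (fun z : ℝ × EuclideanSpace ℝ (Fin n) => testFun n r z.1 z.2) := by
  have : ContDiff ℝ ∞ (parabolicScaling (n := n) r) := by
    unfold parabolicScaling
    fun_prop
  exact (contDiff_cutoff_pow (n + 2)).comp this

lemma testFun_nonneg (r t : ℝ) (x : EuclideanSpace ℝ (Fin n)) : 0 ≤ testFun n r t x :=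
  pow_nonneg (cutoff n).nonneg _

lemma testFun_le_one (r t : ℝ) (x : EuclideanSpace ℝ (Fin n)) : testFun n r t x ≤ 1 :=
  pow_le_one₀ (cutoff n).nonneg (cutoff n).le_one

lemma bounds_of_norm_parabolicScaling_le {r : ℝ} (hr : 0 < r) {z : ℝ × EuclideanSpace ℝ (Fin n)}
    (h : ‖parabolicScaling r z‖ ≤ 3) : |z.1| ≤ r ^ 2 ∧ ‖z.2‖ ≤ 3 * r := by
  rw [parabolicScaling, Prod.norm_def, max_le_iff, norm_mul, norm_smul] at h
  obtain ⟨h1, h2⟩ := h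
  rw [Real.norm_of_nonneg (by positivity), Real.norm_eq_abs] at h1
  rw [Real.norm_of_nonneg (by positivity), inv_mul_le_iff₀ hr] at h2
  refine ⟨?_, by linarith⟩
  rw [div_mul_eq_mul_div, div_le_iff₀ (by positivity)] at h1
  linarith

lemma tsupport_testFun_subset {r : ℝ} (hr : 0 < r) :
    tsupport (fun z : ℝ × EuclideanSpace ℝ (Fin n) => testFun n r z.1 z.2) ⊆
      Icc (-r ^ 2) (r ^ 2) ×ˢ Metric.closedBall 0 (3 * r) := by
  refine closure_minimal (fun z hz => ?_) (isClosed_Icc.prod Metric.isClosed_closedBall)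
  have : ‖parabolicScaling r z‖ ≤ 3 := by
    by_contra! h
    exact hz (by simp [testFun, cutoff_eq_zero h.le])
  obtain ⟨h1, h2⟩ := bounds_of_norm_parabolicScaling_le hr this
  exact ⟨abs_le.1 h1, by simpa using h2⟩

lemma cutoff_parabolicScaling_eq_zero {r : ℝ} (hr : 0 < r) {z : ℝ × EuclideanSpace ℝ (Fin n)}
    (h0 : 0 ≤ z.1) (hz : z ∉ parabolicCylinder n r) : cutoff n (parabolicScaling r z) = 0 := by
  refine cutoff_eq_zero ?_
  by_contra! h
  obtain ⟨h1, h2⟩ := bounds_of_norm_parabolicScaling_le hr h.le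
  exact hz ⟨⟨h0, (abs_le.1 h1).2⟩, by simpa using h2⟩

lemma two_mul_norm_parabolicScaling_le {r : ℝ} (z : ℝ × EuclideanSpace ℝ (Fin n)) :
    2 * ‖parabolicScaling r z‖ ≤ ‖parabolicScaling (r / 2) z‖ := by
  have h1 : (3 / (r / 2) ^ 2 * z.1) = 4 * (3 / r ^ 2 * z.1) := by ring
  have h2 : (r / 2)⁻¹ • z.2 = (2 : ℝ) • r⁻¹ • z.2 := by
    rw [smul_smul, inv_div, div_eq_mul_inv]
  rw [parabolicScaling, parabolicScaling, h1, h2, Prod.norm_def, Prod.norm_def, norm_mul,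
    norm_smul (2 : ℝ)]
  simp only [Real.norm_ofNat]
  rw [mul_max_of_nonneg _ _ zero_le_two]
  have : 0 ≤ 3 / r ^ 2 * |z.1| := by positivity
  gcongr
  simp
  linarith

/-- Off the ball on which the cutoff at scale `r` is flat, the test function at the next smaller
dyadic scale vanishes. -/
lemma testFun_half_eq_zero {r : ℝ} {z : ℝ × EuclideanSpace ℝ (Fin n)}
    (h : 2 ≤ ‖parabolicScaling r z‖) : testFun n (r / 2) z.1 z.2 = 0 := by
  have := two_mul_norm_parabolicScaling_le (r := r) z
  simp [testFun, cutoff_eq_zero (n := n) (z := parabolicScaling (r / 2) z) (by linarith)]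

lemma testFun_half_le (r : ℝ) (z : ℝ × EuclideanSpace ℝ (Fin n)) :
    testFun n (r / 2) z.1 z.2 ≤ testFun n r z.1 z.2 := by
  rcases le_total ‖parabolicScaling r z‖ 2 with h | h
  · refine (testFun_le_one _ _ _).trans_eq ?_
    simp [testFun, cutoff_eq_one h]
  · rw [testFun_half_eq_zero h]
    exact testFun_nonneg _ _ _

/-- The root `cutoff ^ n` of the test function, restricted to the region where the test function
at scale `r` is not locally constant equal to `1`. -/
noncomputable def shell (n : ℕ) (r : ℝ) (z : ℝ × EuclideanSpace ℝ (Fin n)) : ℝ :=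
  {z | 2 ≤ ‖parabolicScaling r z‖}.indicator (fun z => cutoff n (parabolicScaling r z) ^ n) z

lemma shell_nonneg (r : ℝ) (z : ℝ × EuclideanSpace ℝ (Fin n)) : 0 ≤ shell n r z :=
  indicator_nonneg (fun _ _ => pow_nonneg (cutoff n).nonneg _) _

lemma shell_le_one (r : ℝ) (z : ℝ × EuclideanSpace ℝ (Fin n)) : shell n r z ≤ 1 := by
  unfold shell indicator
  split_ifs
  exacts [pow_le_one₀ (cutoff n).nonneg (cutoff n).le_one, zero_le_one]

lemma measurable_shell (r : ℝ) : Measurable (shell n r) := by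
  have h := continuous_parabolicScaling (n := n) r
  exact (((cutoff n).continuous.comp h).pow n).measurable.indicator
    (isClosed_le continuous_const h.norm).measurableSet

/-- The energy in the shell at scale `r` is at most the difference of two consecutive dyadic
test functions. -/
lemma shell_rpow_le (hn : n ≠ 0) (r : ℝ) (z : ℝ × EuclideanSpace ℝ (Fin n)) :
    shell n r z ^ (1 + 2 / (n : ℝ)) ≤ testFun n r z.1 z.2 - testFun n (r / 2) z.1 z.2 := by
  by_cases h : 2 ≤ ‖parabolicScaling r z‖
  · rw [testFun_half_eq_zero h, sub_zero, shell, indicator_of_mem (by exact h), testFun,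
      ← Real.rpow_natCast, ← Real.rpow_mul (cutoff n).nonneg, ← Real.rpow_natCast]
    apply le_of_eq
    congr 1
    push_cast
    field_simp
  · rw [shell, indicator_of_notMem (by exact h), Real.zero_rpow (by positivity), sub_nonneg]
    exact testFun_half_le r z

end

lemma abs_apply_apply_le_opNorm {F : Type*} [NormedAddCommGroup F] [NormedSpace ℝ F]
    (T : F →L[ℝ] F →L[ℝ] ℝ) {v : F} (hv : ‖v‖ ≤ 1) : |T v v| ≤ ‖T‖ :=
  ((T v).unit_le_opNorm v hv).trans (T.unit_le_opNorm v hv)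

/-- On the shell the derivatives of the test function are controlled by its `p`-th root; inside
the shell the test function is locally constant, and they vanish. -/
lemma exists_abs_adjointOp_testFun_le (n : ℕ) :
    ∃ M : ℝ, 0 < M ∧ ∀ r : ℝ, 1 ≤ r → ∀ z : ℝ × EuclideanSpace ℝ (Fin n),
      |adjointOp (testFun n r) z.1 z.2| ≤ M / r ^ 2 * shell n r z := by
  obtain ⟨M, hM0, hM⟩ := exists_norm_fderiv_pow_le (cutoff n).contDiff (cutoff n).hasCompactSupport
    (fun _ => (cutoff n).nonneg) (fun _ => (cutoff n).le_one) n
  refine ⟨M * (n + 12) + 1, by positivity, fun r hr z => ?_⟩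
  have hr0 : 0 < r := by linarith
  set χ := fun z => cutoff n z ^ (n + 2) with hχ
  have hform := (adjointOp_comp_scaling (contDiff_cutoff_pow (n := n) (n + 2)) (3 / r ^ 2) r⁻¹
    z.1 z.2)
  change adjointOp (testFun n r) z.1 z.2 = _ at hform
  rw [hform]
  change |(3 / r ^ 2) ^ 2 * fderiv ℝ (fderiv ℝ χ) (parabolicScaling r z) (1, 0) (1, 0) -
    r⁻¹ ^ 2 * ∑ i : Fin n, fderiv ℝ (fderiv ℝ χ) (parabolicScaling r z)
      (0, EuclideanSpace.single i 1) (0, EuclideanSpace.single i 1) -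
    3 / r ^ 2 * fderiv ℝ χ (parabolicScaling r z) (1, 0)| ≤ _
  by_cases h : 2 ≤ ‖parabolicScaling r z‖
  · rw [shell, indicator_of_mem (by exact h)]
    obtain ⟨h1, h2⟩ := hM (parabolicScaling r z)
    set B := cutoff n (parabolicScaling r z) ^ n
    have hB : 0 ≤ B := pow_nonneg (cutoff n).nonneg _
    have e1 : ‖((1, 0) : ℝ × EuclideanSpace ℝ (Fin n))‖ ≤ 1 := by simp [Prod.norm_def]
    have e2 : ∀ i, ‖((0, EuclideanSpace.single i 1) : ℝ × EuclideanSpace ℝ (Fin n))‖ ≤ 1 :=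
      fun i => by simp [Prod.norm_def]
    have b1 : |fderiv ℝ χ (parabolicScaling r z) (1, 0)| ≤ M * B :=
      ((fderiv ℝ χ _).unit_le_opNorm _ e1).trans h1
    have b2 : ∀ v : ℝ × EuclideanSpace ℝ (Fin n), ‖v‖ ≤ 1 →
        |fderiv ℝ (fderiv ℝ χ) (parabolicScaling r z) v v| ≤ M * B := fun v hv =>
      (abs_apply_apply_le_opNorm _ hv).trans h2
    have b3 : |∑ i : Fin n, fderiv ℝ (fderiv ℝ χ) (parabolicScaling r z)
        (0, EuclideanSpace.single i 1) (0, EuclideanSpace.single i 1)| ≤ n * (M * B) := by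
      refine (Finset.abs_sum_le_sum_abs _ _).trans ?_
      refine (Finset.sum_le_sum fun i _ => b2 _ (e2 i)).trans_eq ?_
      simp
    -- `1 ≤ r` makes the second time derivative, of order `r⁻⁴`, subordinate to the other terms.
    have hr4 : (3 / r ^ 2) ^ 2 ≤ 9 / r ^ 2 := by
      rw [div_pow]
      have : r ^ 2 ≤ (r ^ 2) ^ 2 := by nlinarith [one_le_pow₀ hr (n := 2)]
      norm_num
      gcongr
    refine (abs_sub _ _).trans ((add_le_add_left (abs_sub _ _) _).trans ?_)
    rw [abs_mul, abs_mul, abs_mul, abs_of_nonneg (a := (3 / r ^ 2) ^ 2) (by positivity),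
      abs_of_nonneg (a := r⁻¹ ^ 2) (by positivity), abs_of_nonneg (a := 3 / r ^ 2) (by positivity)]
    calc _ ≤ 9 / r ^ 2 * (M * B) + r⁻¹ ^ 2 * (n * (M * B)) + 3 / r ^ 2 * (M * B) := by
          gcongr
          exact b2 _ e1
      _ = M * (n + 12) / r ^ 2 * B := by field_simp; ring
      _ ≤ _ := by gcongr; linarith
  · have hev : χ =ᶠ[nhds (parabolicScaling r z)] fun _ => 1 := by
      filter_upwards [(cutoff n).eventuallyEq_one_of_mem_ball
        (x := parabolicScaling r z) (by simpa [cutoff] using h)] with y hy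
      simp [hχ, hy]
    have hev' : fderiv ℝ χ =ᶠ[nhds (parabolicScaling r z)] fun _ => 0 := by
      filter_upwards [hev.eventuallyEq_nhds] with y hy
      rw [hy.fderiv_eq]
      simp
    rw [hev'.fderiv_eq, hev'.eq_of_nhds, shell, indicator_of_notMem (by exact h)]
    simp

lemma testFun_zero_eq_one {n : ℕ} {r : ℝ} (hr : 1 ≤ r) {x : EuclideanSpace ℝ (Fin n)}
    (hx : ‖x‖ ≤ 1) : testFun n r 0 x = 1 ∧ deriv (fun s => testFun n r s x) 0 = 0 := by
  have hz : ‖parabolicScaling r ((0 : ℝ), x)‖ < 2 := by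
    simp only [parabolicScaling, mul_zero, Prod.norm_def, norm_zero, norm_smul, norm_inv]
    rw [Real.norm_of_nonneg (by linarith)]
    have : r⁻¹ * ‖x‖ ≤ 1 := mul_le_one₀ (inv_le_one_of_one_le₀ hr) (norm_nonneg _) hx
    exact max_lt (by norm_num) (by linarith)
  refine ⟨by simp [testFun, cutoff_eq_one hz.le], ?_⟩
  have hcont : Continuous fun s : ℝ => parabolicScaling r (s, x) :=
    (continuous_parabolicScaling r).comp (by fun_prop)
  have hev : (fun s => testFun n r s x) =ᶠ[nhds 0] fun _ => 1 := by
    filter_upwards [(isOpen_lt hcont.norm continuous_const).mem_nhds hz] with s hs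
    simp [testFun, cutoff_eq_one (le_of_lt hs)]
  rw [hev.deriv_eq]
  simp

/-! ### The estimate at a single scale -/

/-- The part of `∫ |u|^p`, `p = 1 + 2 / n`, seen by the test function at scale `r`. -/
noncomputable def weightedMass (n : ℕ) (T : ℝ≥0∞) (u : ℝ → EuclideanSpace ℝ (Fin n) → ℝ) (r : ℝ) :
    ℝ :=
  ∫ z in slab n T, |u z.1 z.2| ^ (1 + 2 / (n : ℝ)) * testFun n r z.1 z.2

section
variable {n : ℕ}

lemma measurableSet_slab (T : ℝ≥0∞) : MeasurableSet (slab n T) :=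
  (measurableSet_le measurable_const measurable_fst).inter
    (measurableSet_lt (ENNReal.measurable_ofReal.comp measurable_fst) measurable_const)

lemma isCompact_cylinder (r : ℝ) : IsCompact (parabolicCylinder n r) :=
  isCompact_Icc.prod (isCompact_closedBall _ _)

lemma cylinder_subset_slab {T : ℝ≥0∞} {r : ℝ} (hT : ENNReal.ofReal (r ^ 2) < T) :
    parabolicCylinder n r ⊆ slab n T := fun _ hz =>
  ⟨hz.1.1, (ENNReal.ofReal_le_ofReal hz.1.2).trans_lt hT⟩

lemma volume_real_cylinder {r : ℝ} (hr : 0 ≤ r) :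
    volume.real (parabolicCylinder n r) =
      3 ^ n * volume.real (Metric.ball (0 : EuclideanSpace ℝ (Fin n)) 1) * r ^ (n + 2) := by
  rw [parabolicCylinder, Measure.volume_eq_prod, measureReal_prod_prod, Real.volume_real_Icc_of_le
    (by positivity), Measure.addHaar_real_closedBall _ _ (by positivity)]
  simp only [finrank_euclideanSpace, Fintype.card_fin]
  ring

lemma weightedMass_nonneg (T : ℝ≥0∞) (u : ℝ → EuclideanSpace ℝ (Fin n) → ℝ) (r : ℝ) :
    0 ≤ weightedMass n T u r :=
  integral_nonneg fun _ => mul_nonneg (by positivity) (testFun_nonneg _ _ _)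

lemma setIntegral_slab_eq_cylinder {T : ℝ≥0∞} {r : ℝ} (hT : ENNReal.ofReal (r ^ 2) < T)
    {F : ℝ × EuclideanSpace ℝ (Fin n) → ℝ}
    (hF : ∀ z, 0 ≤ z.1 → z ∉ parabolicCylinder n r → F z = 0) :
    ∫ z in slab n T, F z = ∫ z in parabolicCylinder n r, F z :=
  setIntegral_eq_of_subset_of_forall_sdiff_eq_zero (measurableSet_slab T)
    (cylinder_subset_slab hT) fun z hz => hF z hz.1.1 hz.2

/-- Hölder's inequality on the shell. The measure of the cylinder is proportional to `r ^ (n + 2)`,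
so its contribution, with conjugate exponent `(n + 2) / 2`, is proportional to `r ^ 2`. -/
lemma integral_mul_shell_le (hn : n ≠ 0) {T : ℝ≥0∞} {u : ℝ → EuclideanSpace ℝ (Fin n) → ℝ}
    {r : ℝ} (hr : 0 < r) (hT : ENNReal.ofReal (r ^ 2) < T)
    (hu : MemLp (fun z : ℝ × EuclideanSpace ℝ (Fin n) => u z.1 z.2)
      (ENNReal.ofReal (1 + 2 / (n : ℝ))) (volume.restrict (parabolicCylinder n r))) :
    Integrable (fun z => |u z.1 z.2| * shell n r z) (volume.restrict (parabolicCylinder n r)) ∧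
    0 ≤ weightedMass n T u r - weightedMass n T u (r / 2) ∧
    ∫ z in parabolicCylinder n r, |u z.1 z.2| * shell n r z ≤
      (weightedMass n T u r - weightedMass n T u (r / 2)) ^ (1 / (1 + 2 / (n : ℝ))) *
        ((3 ^ n * volume.real (Metric.ball (0 : EuclideanSpace ℝ (Fin n)) 1)) ^
          (2 / ((n : ℝ) + 2)) * r ^ 2) := by
  have hn0 : (0 : ℝ) < n := by positivity
  set p : ℝ := 1 + 2 / (n : ℝ) with hp
  set μ := volume.restrict (parabolicCylinder n r) with hμ
  have hp1 : 1 < p := by rw [hp]; linarith [div_pos two_pos hn0]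
  have hp0 : 0 < p := by linarith
  have : IsFiniteMeasure μ := ⟨by simpa [hμ] using (isCompact_cylinder r).measure_lt_top⟩
  have hpq : p.HolderConjugate (((n : ℝ) + 2) / 2) := by
    rw [Real.holderConjugate_iff]
    refine ⟨hp1, ?_⟩
    rw [hp]
    field_simp
  have hv : MemLp (fun z => |u z.1 z.2| * shell n r z) (ENNReal.ofReal p) μ := by
    refine hu.mono (hu.norm.aestronglyMeasurable.mul (measurable_shell r).aestronglyMeasurable)
      (Filter.Eventually.of_forall fun z => ?_)
    rw [norm_mul, Real.norm_of_nonneg (shell_nonneg r z), Real.norm_eq_abs, abs_abs]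
    exact mul_le_of_le_one_right (abs_nonneg _) (shell_le_one r z)
  have hup : Integrable (fun z : ℝ × EuclideanSpace ℝ (Fin n) => |u z.1 z.2| ^ p) μ := by
    have := hu.integrable_norm_rpow (by simpa using hp0) ENNReal.ofReal_ne_top
    rwa [ENNReal.toReal_ofReal hp0.le] at this
  have hφ : ∀ s, Integrable
      (fun z : ℝ × EuclideanSpace ℝ (Fin n) => |u z.1 z.2| ^ p * testFun n s z.1 z.2) μ :=
    fun s => hup.mul_bdd (c := 1) (contDiff_testFun s).continuous.aestronglyMeasurable
      (Filter.Eventually.of_forall fun z => by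
        rw [Real.norm_of_nonneg (testFun_nonneg _ _ _)]
        exact testFun_le_one _ _ _)
  have hzero : ∀ z : ℝ × EuclideanSpace ℝ (Fin n), 0 ≤ z.1 → z ∉ parabolicCylinder n r →
      testFun n r z.1 z.2 = 0 := fun z h0 hz => by
    simp [testFun, cutoff_parabolicScaling_eq_zero hr h0 hz]
  have hm : weightedMass n T u r = ∫ z, |u z.1 z.2| ^ p * testFun n r z.1 z.2 ∂μ :=
    setIntegral_slab_eq_cylinder hT fun z h0 hz => by rw [hzero z h0 hz, mul_zero]
  have hm' : weightedMass n T u (r / 2) = ∫ z, |u z.1 z.2| ^ p * testFun n (r / 2) z.1 z.2 ∂μ :=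
    setIntegral_slab_eq_cylinder hT fun z h0 hz => by
      rw [le_antisymm ((testFun_half_le r z).trans_eq (hzero z h0 hz)) (testFun_nonneg _ _ _),
        mul_zero]
  have hmass : ∫ z, (|u z.1 z.2| * shell n r z) ^ p ∂μ ≤
      weightedMass n T u r - weightedMass n T u (r / 2) := by
    rw [hm, hm', ← integral_sub (hφ r) (hφ (r / 2))]
    refine integral_mono_of_nonneg (Filter.Eventually.of_forall fun z => ?_)
      ((hφ r).sub (hφ (r / 2))) (Filter.Eventually.of_forall fun z => ?_)
    · exact Real.rpow_nonneg (mul_nonneg (abs_nonneg _) (shell_nonneg r z)) _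
    · simp only
      rw [Real.mul_rpow (abs_nonneg _) (shell_nonneg r z), ← mul_sub]
      exact mul_le_mul_of_nonneg_left (shell_rpow_le hn r z) (by positivity)
  have hpow : 0 ≤ ∫ z, (|u z.1 z.2| * shell n r z) ^ p ∂μ :=
    integral_nonneg fun z => Real.rpow_nonneg (mul_nonneg (abs_nonneg _) (shell_nonneg r z)) _
  refine ⟨hv.integrable (by simpa using hp1.le), hpow.trans hmass, ?_⟩
  have hol := integral_mul_le_Lp_mul_Lq_of_nonneg (μ := μ) hpq
    (f := fun z => |u z.1 z.2| * shell n r z) (g := fun _ => 1)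
    (Filter.Eventually.of_forall fun z => mul_nonneg (abs_nonneg _) (shell_nonneg r z))
    (Filter.Eventually.of_forall fun _ => zero_le_one) hv (memLp_const 1)
  simp only [mul_one, Real.one_rpow, integral_const, smul_eq_mul] at hol
  have hvol : μ.real univ ^ (1 / (((n : ℝ) + 2) / 2)) =
      (3 ^ n * volume.real (Metric.ball (0 : EuclideanSpace ℝ (Fin n)) 1)) ^
          (2 / ((n : ℝ) + 2)) * r ^ 2 := by
    rw [hμ, measureReal_restrict_apply_univ, volume_real_cylinder hr.le, one_div_div,
      Real.mul_rpow (by positivity) (by positivity), ← Real.rpow_natCast r (n + 2),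
      ← Real.rpow_mul hr.le, ← Real.rpow_natCast r 2]
    congr 2
    push_cast
    field_simp
  rw [hvol] at hol
  refine hol.trans ?_
  gcongr

/-- For data supported in the unit ball, the initial term of the weak formulation is the total mass
of the data: near `t = 0`, the test function is `1` on the unit ball. -/
lemma integral_data_testFun {u₀ u₁ : EuclideanSpace ℝ (Fin n) → ℝ}
    (h₀ : ∀ᵐ x, 1 < ‖x‖ → u₀ x = 0) (h₁ : ∀ᵐ x, 1 < ‖x‖ → u₁ x = 0) {r : ℝ} (hr : 1 ≤ r) :
    ∫ x, ((u₀ x + u₁ x) * testFun n r 0 x - u₀ x * deriv (fun s => testFun n r s x) 0) =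
      ∫ x, (u₀ x + u₁ x) := by
  refine integral_congr_ae ?_
  filter_upwards [h₀, h₁] with x hx₀ hx₁
  rcases le_or_gt ‖x‖ 1 with hx | hx
  · simp [testFun_zero_eq_one hr hx]
  · simp [hx₀ hx, hx₁ hx]

end

/-- The test function at scale `r` in the weak formulation: mass of the data plus mass of the
solution is controlled by what the solution gains between two consecutive dyadic scales. The power
of `r` cancels because `p = 1 + 2 / n` is critical. -/
theorem exists_rpow_weightedMass_le (n : ℕ) (hn : n ≠ 0) :
    ∃ D : ℝ, 0 < D ∧ ∀ (T : ℝ≥0∞) (u₀ u₁ : EuclideanSpace ℝ (Fin n) → ℝ)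
      (u : ℝ → EuclideanSpace ℝ (Fin n) → ℝ),
      (∀ᵐ x, 1 < ‖x‖ → u₀ x = 0) → (∀ᵐ x, 1 < ‖x‖ → u₁ x = 0) → 0 ≤ ∫ x, (u₀ x + u₁ x) →
      IsWeakSolution (1 + 2 / (n : ℝ)) T u₀ u₁ u →
      ∀ r : ℝ, 1 ≤ r → ENNReal.ofReal (r ^ 2) < T →
        ((∫ x, (u₀ x + u₁ x)) + weightedMass n T u r) ^ (1 + 2 / (n : ℝ)) ≤
          D * (weightedMass n T u r - weightedMass n T u (r / 2)) := by
  obtain ⟨M, hM0, hM⟩ := exists_abs_adjointOp_testFun_le n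
  set p : ℝ := 1 + 2 / (n : ℝ) with hp
  have hp0 : 0 < p := by positivity
  set V := (3 ^ n * volume.real (Metric.ball (0 : EuclideanSpace ℝ (Fin n)) 1)) ^
    (2 / ((n : ℝ) + 2))
  have hball : 0 < volume.real (Metric.ball (0 : EuclideanSpace ℝ (Fin n)) 1) :=
    ENNReal.toReal_pos (Metric.measure_ball_pos _ _ one_pos).ne' measure_ball_lt_top.ne
  have hV0 : 0 < V := by positivity
  refine ⟨(M * V) ^ p, by positivity, fun T u₀ u₁ u h₀ h₁ hJ hu r hr hT => ?_⟩
  have hr0 : 0 < r := by linarith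
  have hsupp := tsupport_testFun_subset (n := n) hr0
  have hweak := hu.weak_eq (testFun n r) (contDiff_testFun r)
    ((isCompact_Icc.prod (isCompact_closedBall _ _)).of_isClosed_subset (isClosed_tsupport _) hsupp)
    (fun z hz => (ENNReal.ofReal_le_ofReal (hsupp hz).1.2).trans_lt hT)
  rw [integral_data_testFun h₀ h₁ hr] at hweak
  obtain ⟨hint, hmono, hhol⟩ := integral_mul_shell_le hn hr0 hT
    (hu.memLp _ (isCompact_cylinder r) (cylinder_subset_slab hT))
  set gain := weightedMass n T u r - weightedMass n T u (r / 2)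
  have hbound : ∀ z : ℝ × EuclideanSpace ℝ (Fin n), ‖u z.1 z.2 * adjointOp (testFun n r) z.1 z.2‖ ≤
      M / r ^ 2 * (|u z.1 z.2| * shell n r z) := fun z => by
    rw [norm_mul, Real.norm_eq_abs, Real.norm_eq_abs, mul_left_comm]
    exact mul_le_mul_of_nonneg_left (hM r hr z) (abs_nonneg _)
  have hshell : ∀ z : ℝ × EuclideanSpace ℝ (Fin n), 0 ≤ z.1 → z ∉ parabolicCylinder n r →
      shell n r z = 0 := fun z h0 hz => by
    rw [shell]
    exact indicator_apply_eq_zero.2 fun _ => by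
      rw [cutoff_parabolicScaling_eq_zero hr0 h0 hz, zero_pow hn]
  have hlin : (∫ x, (u₀ x + u₁ x)) + weightedMass n T u r ≤ M * V * gain ^ (1 / p) := by
    calc (∫ x, (u₀ x + u₁ x)) + weightedMass n T u r
        = ∫ z in slab n T, u z.1 z.2 * adjointOp (testFun n r) z.1 z.2 := by
          rw [hweak, add_comm]; rfl
      _ = ∫ z in parabolicCylinder n r, u z.1 z.2 * adjointOp (testFun n r) z.1 z.2 :=
          setIntegral_slab_eq_cylinder hT fun z h0 hz => by
            have := hbound z
            rw [hshell z h0 hz, mul_zero, mul_zero] at this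
            exact norm_le_zero_iff.1 this
      _ ≤ ∫ z in parabolicCylinder n r, M / r ^ 2 * (|u z.1 z.2| * shell n r z) :=
          (le_abs_self _).trans (norm_integral_le_of_norm_le (hint.const_mul _)
            (Filter.Eventually.of_forall hbound))
      _ ≤ M / r ^ 2 * (gain ^ (1 / p) * (V * r ^ 2)) := by
          rw [integral_const_mul]
          gcongr
      _ = M * V * gain ^ (1 / p) := by field_simp
  calc _ ≤ (M * V * gain ^ (1 / p)) ^ p :=
        Real.rpow_le_rpow (add_nonneg hJ (weightedMass_nonneg _ _ _)) hlin hp0.le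
    _ = (M * V) ^ p * gain := by
        rw [Real.mul_rpow (by positivity) (by positivity), ← Real.rpow_mul hmono,
          one_div_mul_cancel hp0.ne', Real.rpow_one]

/-! ### Summation over the dyadic scales -/

lemma integrable_of_memLp_two_of_ae_eq_zero {n : ℕ} {f : EuclideanSpace ℝ (Fin n) → ℝ}
    (hf : MemLp f 2 volume) (hs : ∀ᵐ x, 1 < ‖x‖ → f x = 0) : Integrable f := by
  have h : IntegrableOn f (Metric.closedBall 0 1) :=
    have : IsFiniteMeasure (volume.restrict (Metric.closedBall (0 : EuclideanSpace ℝ (Fin n)) 1)) :=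
      ⟨by simpa using measure_closedBall_lt_top⟩
    (hf.restrict _).integrable (by norm_num)
  refine h.integrable_of_ae_notMem_eq_zero ?_
  filter_upwards [hs] with x hx hmem
  exact hx (by simpa using hmem)

theorem theorem1 (n : ℕ) (hn : 4 ≤ n) (f g : EuclideanSpace ℝ (Fin n) → ℝ)
    (hf : MemH1 f) (hg : MemLp g 2 volume)
    (hf_supp : ∀ᵐ x, 1 < ‖x‖ → f x = 0) (hg_supp : ∀ᵐ x, 1 < ‖x‖ → g x = 0)
    (hf_nonneg : ∀ᵐ x, 0 ≤ f x) (hg_nonneg : ∀ᵐ x, 0 ≤ g x)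
    (h_nontrivial : ¬ ((∀ᵐ x, f x = 0) ∧ (∀ᵐ x, g x = 0))) :
    ∃ C : ℝ, 0 < C ∧
      ∀ ε : ℝ, 0 < ε → ∀ (T : ℝ≥0∞) (u : ℝ → EuclideanSpace ℝ (Fin n) → ℝ),
        IsWeakSolution (1 + 2 / (n : ℝ)) T (fun x => ε * f x) (fun x => ε * g x) u →
          T ≤ ENNReal.ofReal (Real.exp (C * ε ^ (-(2 / (n : ℝ))))) := by
  obtain ⟨D, hD, hmain⟩ := exists_rpow_weightedMass_le n (by omega)
  have hq : 0 < 2 / (n : ℝ) := by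
    have : 0 < n := by omega
    positivity
  have hI : 0 < ∫ x, (f x + g x) := by
    have hfg0 : ∀ᵐ x, 0 ≤ f x + g x := by
      filter_upwards [hf_nonneg, hg_nonneg] with x h1 h2 using add_nonneg h1 h2
    refine (integral_nonneg_of_ae hfg0).lt_of_ne' fun h => h_nontrivial ?_
    have h0 := (integral_eq_zero_iff_of_nonneg_ae hfg0
      ((integrable_of_memLp_two_of_ae_eq_zero hf.1 hf_supp).add
        (integrable_of_memLp_two_of_ae_eq_zero hg hg_supp))).1 h
    constructor <;> filter_upwards [h0, hf_nonneg, hg_nonneg] with x hx h1 h2 <;>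
      simp only [Pi.zero_apply] at hx <;> linarith
  set I := ∫ x, (f x + g x)
  have hlog : 0 < Real.log 4 := Real.log_pos (by norm_num)
  refine ⟨Real.log 4 * (D / (2 / (n : ℝ)) * I ^ (-(2 / (n : ℝ)))), by positivity,
    fun ε hε T u hu => ?_⟩
  by_contra! hT
  have hJ : ∫ x, (ε * f x + ε * g x) = ε * I := by
    rw [← integral_const_mul]
    simp only [mul_add]
  set L := D / (2 / (n : ℝ)) * (ε * I) ^ (-(2 / (n : ℝ))) with hL
  have hL0 : 0 ≤ L := by positivity
  have hexp : Real.log 4 * (D / (2 / (n : ℝ)) * I ^ (-(2 / (n : ℝ)))) * ε ^ (-(2 / (n : ℝ))) =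
      Real.log 4 * L := by
    rw [hL, Real.mul_rpow hε.le hI.le]
    ring
  rw [hexp] at hT
  have hε0 : 0 < ε * I := mul_pos hε hI
  -- The scales `r = 2 ^ k` with `k ≤ L` all fit into the lifespan, since `r ^ 2 = 4 ^ k`.
  have hsteps := steps_le_of_rpow_le_mul_sub (N := ⌊L⌋₊ + 1)
    (b := fun k => ε * I + weightedMass n T u (2 ^ k / 2)) hq hD
    (fun k => add_pos_of_pos_of_nonneg hε0 (weightedMass_nonneg _ _ _)) (fun k hk => by
      have hkL : (k : ℝ) ≤ L := (Nat.le_floor_iff hL0).1 (Nat.lt_succ_iff.1 hk)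
      have hr : ENNReal.ofReal (((2 : ℝ) ^ k) ^ 2) < T := by
        refine (ENNReal.ofReal_le_ofReal ?_).trans_lt hT
        rw [← pow_mul, mul_comm, pow_mul, ← Real.rpow_natCast, Real.rpow_def_of_pos (by norm_num)]
        norm_num
        exact mul_le_mul_of_nonneg_left hkL hlog.le
      have := hmain T _ _ u (by filter_upwards [hf_supp] with x hx h using by simp [hx h])
        (by filter_upwards [hg_supp] with x hx h using by simp [hx h]) (hJ ▸ hε0.le) hu (2 ^ k)
        (one_le_pow₀ one_le_two) hr
      rw [hJ] at this
      rw [pow_succ, mul_div_cancel_right₀ _ two_ne_zero, add_sub_add_left_eq_sub]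
      exact this)
  have hb0 : (ε * I + weightedMass n T u (2 ^ 0 / 2)) ^ (-(2 / (n : ℝ))) ≤
      (ε * I) ^ (-(2 / (n : ℝ))) :=
    Real.rpow_le_rpow_of_nonpos hε0 (le_add_of_nonneg_right (weightedMass_nonneg _ _ _))
      (by linarith)
  have hle : ((⌊L⌋₊ + 1 : ℕ) : ℝ) ≤ L := by
    have := hsteps.trans hb0
    rw [mul_div_assoc', div_le_iff₀' hD, ← le_div_iff₀ hq] at this
    exact this.trans_eq (by rw [hL, div_mul_eq_mul_div])
  push_cast at hle
  linarith [Nat.lt_floor_add_one L]
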